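/- Let $\Bbbk$ be an infinite field, let $\nu\ge 1$, let $n_\nu<\cdots<n_1$ be pairwise relatively prime positive integers, $N=\prod_{i=1}^{\nu}n_i$, $g_i=N/n_i$, and let $S=\langle g_1,\dots,g_\nu\rangle\subseteq\mathbb N$ be the submonoid of $(\mathbb N,+)$ generated by the $g_i$. Let $R=\Bbbk[[t^S]]$ be the ring of formal power series over $\Bbbk$ all of whose exponents lie in $S$, a local ring with maximal ideal $\mathfrak m$, and let $\mathrm{gr}_{\mathfrak m}(R)=\bigoplus_{i\ge 0}\mathfrak m^i/\mathfrak m^{i+1}$. Then $\mathrm{gr}_{\mathfrak m}(R)$ is a complete intersection. Here a *minimal generator* of $S$ is a nonzero element of $S$ that is not a sum of two nonzero elements of $S$, and *complete intersection* means the following: if $h_1,\dots,h_e$ are the distinct minimal generators of $S$ and $I^*$ is the kernel of the $\Bbbk$-algebra homomorphism $\Bbbk[x_1,\dots,x_e]\to\mathrm{gr}_{\mathfrak m}(R)$ sending $x_j$ to the class of $t^{h_j}$ in $\mathfrak m/\mathfrak m^2$, then the minimal number of generators of the ideal $I^*$ is $\mu(I^*)=e-1$. -/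

import Mathlib

open scoped PowerSeries DirectSum

noncomputable section

namespace NumSgp

section AssociatedGraded

variable {R : Type*} [CommRing R] (I : Ideal R)

/-- The degree `n` piece `I ^ n / I ^ (n + 1)` of the associated graded ring. -/
def GrPiece (n : ℕ) : Type _ :=
  ↥(I ^ n) ⧸ Submodule.comap (Submodule.subtype (I ^ n)) (I ^ (n + 1))

instance (n : ℕ) : AddCommGroup (GrPiece I n) :=
  inferInstanceAs (AddCommGroup
    (↥(I ^ n) ⧸ Submodule.comap (Submodule.subtype (I ^ n)) (I ^ (n + 1))))

/-- The class in `I ^ n / I ^ (n + 1)` of an element `a` of `I ^ n`. -/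
def grMk (n : ℕ) (a : R) (ha : a ∈ I ^ n) : GrPiece I n :=
  Submodule.Quotient.mk (p := Submodule.comap (Submodule.subtype (I ^ n)) (I ^ (n + 1))) ⟨a, ha⟩

variable {I}

theorem grMk_surj {n : ℕ} (x : GrPiece I n) : ∃ a ha, grMk I n a ha = x := by
  obtain ⟨⟨a, ha⟩, rfl⟩ := Submodule.Quotient.mk_surjective _ x
  exact ⟨a, ha, rfl⟩

theorem grMk_eq_iff {n : ℕ} {a b : R} {ha : a ∈ I ^ n} {hb : b ∈ I ^ n} :
    grMk I n a ha = grMk I n b hb ↔ a - b ∈ I ^ (n + 1) := by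
  unfold grMk
  exact Submodule.Quotient.eq _

variable (I) in
/-- Multiplication `I ^ i / I ^ (i + 1) × I ^ j / I ^ (j + 1) → I ^ (i + j) / I ^ (i + j + 1)`,
induced by the multiplication of `R`. -/
def grMul (i j : ℕ) (x : GrPiece I i) (y : GrPiece I j) : GrPiece I (i + j) :=
  Quotient.liftOn₂' x y
    (fun a b => grMk I (i + j) (a.1 * b.1) (pow_add I i j ▸ Ideal.mul_mem_mul a.2 b.2))
    (by
      rintro ⟨a, ha⟩ ⟨b, hb⟩ ⟨a', ha'⟩ ⟨b', hb'⟩ h1 h2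
      have h1' : a - a' ∈ I ^ (i + 1) := (Submodule.quotientRel_def (Submodule.comap (Submodule.subtype (I ^ i)) (I ^ (i + 1)))).1 h1
      have h2' : b - b' ∈ I ^ (j + 1) := (Submodule.quotientRel_def (Submodule.comap (Submodule.subtype (I ^ j)) (I ^ (j + 1)))).1 h2
      rw [grMk_eq_iff]
      have e : a * b - a' * b' = (a - a') * b + a' * (b - b') := by ring
      change a * b - a' * b' ∈ _
      rw [e]
      refine Ideal.add_mem _ ?_ ?_
      · have := Ideal.mul_mem_mul h1' hb
        rw [← pow_add] at this
        convert this using 2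
        omega
      · have := Ideal.mul_mem_mul ha' h2'
        rw [← pow_add] at this
        convert this using 2
        omega)

theorem grMul_mk {i j : ℕ} {a b : R} (ha : a ∈ I ^ i) (hb : b ∈ I ^ j) :
    grMul I i j (grMk I i a ha) (grMk I j b hb) =
      grMk I (i + j) (a * b) (pow_add I i j ▸ Ideal.mul_mem_mul ha hb) := rfl

theorem grMk_add {n : ℕ} {a b : R} (ha : a ∈ I ^ n) (hb : b ∈ I ^ n) :
    grMk I n a ha + grMk I n b hb = grMk I n (a + b) (Ideal.add_mem _ ha hb) := rfl

theorem grMk_zero {n : ℕ} : grMk I n 0 (Submodule.zero_mem _) = 0 := rfl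

theorem grMk_congr {n : ℕ} {a b : R} (h : a = b) (ha : a ∈ I ^ n) (hb : b ∈ I ^ n) :
    grMk I n a ha = grMk I n b hb := by subst h; rfl

theorem sigma_grMk_congr {i j : ℕ} {a b : R} (hij : i = j) (h : a = b)
    (ha : a ∈ I ^ i) (hb : b ∈ I ^ j) :
    (⟨i, grMk I i a ha⟩ : GradedMonoid (GrPiece I)) = ⟨j, grMk I j b hb⟩ := by
  subst hij; subst h; rfl

instance : GradedMonoid.GOne (GrPiece I) where
  one := grMk I 0 1 (by simp)

instance : GradedMonoid.GMul (GrPiece I) where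
  mul {i j} x y := grMul I i j x y

instance : GradedMonoid.GMonoid (GrPiece I) where
  one_mul := by
    rintro ⟨i, x⟩
    obtain ⟨a, ha, rfl⟩ := grMk_surj x
    exact sigma_grMk_congr (zero_add i) (one_mul a) _ _
  mul_one := by
    rintro ⟨i, x⟩
    obtain ⟨a, ha, rfl⟩ := grMk_surj x
    exact sigma_grMk_congr (add_zero i) (mul_one a) _ _
  mul_assoc := by
    rintro ⟨i, x⟩ ⟨j, y⟩ ⟨l, z⟩
    obtain ⟨a, ha, rfl⟩ := grMk_surj x
    obtain ⟨b, hb, rfl⟩ := grMk_surj y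
    obtain ⟨c, hc, rfl⟩ := grMk_surj z
    exact sigma_grMk_congr (add_assoc i j l) (mul_assoc a b c) _ _

instance : DirectSum.GCommRing (GrPiece I) where
  mul_zero {i j} x := by
    obtain ⟨a, ha, rfl⟩ := grMk_surj x
    exact grMk_congr (mul_zero a) _ _
  zero_mul {i j} x := by
    obtain ⟨a, ha, rfl⟩ := grMk_surj x
    exact grMk_congr (zero_mul a) _ _
  mul_add {i j} x y z := by
    obtain ⟨a, ha, rfl⟩ := grMk_surj x
    obtain ⟨b, hb, rfl⟩ := grMk_surj y
    obtain ⟨c, hc, rfl⟩ := grMk_surj z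
    exact grMk_congr (mul_add a b c) _ _
  add_mul {i j} x y z := by
    obtain ⟨a, ha, rfl⟩ := grMk_surj x
    obtain ⟨b, hb, rfl⟩ := grMk_surj y
    obtain ⟨c, hc, rfl⟩ := grMk_surj z
    exact grMk_congr (add_mul a b c) _ _
  mul_comm := by
    rintro ⟨i, x⟩ ⟨j, y⟩
    obtain ⟨a, ha, rfl⟩ := grMk_surj x
    obtain ⟨b, hb, rfl⟩ := grMk_surj y
    exact sigma_grMk_congr (add_comm i j) (mul_comm a b) _ _
  natCast n := grMk I 0 (n : R) (by simp)
  natCast_zero := grMk_congr Nat.cast_zero _ _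
  natCast_succ n := grMk_congr (Nat.cast_succ n) _ _
  intCast n := grMk I 0 (n : R) (by simp)
  intCast_ofNat n := grMk_congr (Int.cast_natCast n) _ _
  intCast_negSucc_ofNat n := grMk_congr (Int.cast_negSucc n) _ _

variable (I) in
/-- The associated graded ring `gr_I(R) = ⨁ n, I ^ n / I ^ (n + 1)`, a commutative ring. -/
abbrev Gr : Type _ := ⨁ n, GrPiece I n

variable (I) in
/-- The canonical ring homomorphism `R → R / I = I ^ 0 / I ^ 1 ⊆ gr_I(R)`. -/
def grOfRing : R →+* Gr I where
  toFun a := DirectSum.of (GrPiece I) 0 (grMk I 0 a (by simp))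
  map_one' := rfl
  map_zero' := by
    rw [← map_zero (DirectSum.of (GrPiece I) 0)]
    rfl
  map_mul' a b := by
    rw [DirectSum.of_mul_of]
    rfl
  map_add' a b := by
    rw [← map_add]
    rfl

end AssociatedGraded

section SemigroupRing

variable (k : Type*) [Field k] (S : AddSubmonoid ℕ)

/-- The semigroup ring `k[[t^S]]`: the power series all of whose exponents lie in `S`. -/
def SgpRing : Subalgebra k k⟦X⟧ where
  carrier := {f | ∀ n, PowerSeries.coeff n f ≠ 0 → n ∈ S}
  mul_mem' := by
    intro f g hf hg n hn
    rw [PowerSeries.coeff_mul] at hn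
    obtain ⟨p, hp, hne⟩ := Finset.exists_ne_zero_of_sum_ne_zero hn
    rw [← Finset.HasAntidiagonal.mem_antidiagonal.1 hp]
    exact S.add_mem (hf _ (left_ne_zero_of_mul hne)) (hg _ (right_ne_zero_of_mul hne))
  add_mem' := by
    intro f g hf hg n hn
    by_cases h : PowerSeries.coeff n f = 0
    · exact hg n (by simpa [h] using hn)
    · exact hf n h
  algebraMap_mem' := by
    intro c n hn
    have : n = 0 := by
      by_contra h
      apply hn
      rw [PowerSeries.algebraMap_apply, PowerSeries.coeff_C, if_neg h]
    rw [this]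
    exact S.zero_mem

variable {k S}

theorem inv_mem_sgpRing {f : k⟦X⟧} (hf : f ∈ SgpRing k S) : f⁻¹ ∈ SgpRing k S := by
  intro n
  induction n using Nat.strong_induction_on with
  | _ n ih =>
    intro hn
    rw [PowerSeries.coeff_inv] at hn
    split_ifs at hn with h0
    · rw [h0]; exact S.zero_mem
    · obtain ⟨p, hp, hne⟩ := Finset.exists_ne_zero_of_sum_ne_zero (right_ne_zero_of_mul hn)
      split_ifs at hne with hlt
      · rw [← Finset.HasAntidiagonal.mem_antidiagonal.1 hp]
        exact S.add_mem (hf _ (left_ne_zero_of_mul hne)) (ih _ hlt (right_ne_zero_of_mul hne))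
      · exact absurd rfl hne

theorem isUnit_sgpRing_iff (f : SgpRing k S) :
    IsUnit f ↔ PowerSeries.constantCoeff (f : k⟦X⟧) ≠ 0 := by
  constructor
  · intro h
    have h' := (h.map (SgpRing k S).val).map (PowerSeries.constantCoeff (R := k))
    exact h'.ne_zero
  · intro h
    refine IsUnit.of_mul_eq_one ⟨(f : k⟦X⟧)⁻¹, inv_mem_sgpRing f.2⟩ ?_
    exact Subtype.ext (PowerSeries.mul_inv_cancel _ h)

instance : IsLocalRing (SgpRing k S) :=
  IsLocalRing.of_nonunits_add (by
    intro f g hf hg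
    rw [mem_nonunits_iff, isUnit_sgpRing_iff, not_not] at *
    simp [hf, hg])

variable (k S)

/-- The minimal generators of `S`: the minimal elements of `S \ {0}` for the order
`t ≼ s ↔ ∃ u ∈ S, s = t + u`. -/
def minGens : Set ℕ :=
  {s | s ∈ S ∧ s ≠ 0 ∧ ∀ t ∈ S, t ≠ 0 → (∃ u ∈ S, s = t + u) → t = s}

/-- The monomial `t ^ s` in `k[[t^S]]`, for `s ∈ S`. -/
def tPow (s : ℕ) (hs : s ∈ S) : SgpRing k S :=
  ⟨PowerSeries.X ^ s, by
    intro n hn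
    rw [PowerSeries.coeff_X_pow] at hn
    split_ifs at hn with h
    · rwa [h]
    · exact absurd rfl hn⟩

theorem tPow_mem_maximalIdeal (s : ℕ) (hs : s ∈ S) (h0 : s ≠ 0) :
    tPow k S s hs ∈ IsLocalRing.maximalIdeal (SgpRing k S) := by
  rw [IsLocalRing.mem_maximalIdeal, mem_nonunits_iff, isUnit_sgpRing_iff, not_not]
  simp [tPow, h0]

/-- The associated graded ring `gr_𝔪(R)` of `R = k[[t^S]]` with respect to its maximal ideal. -/
abbrev GrSgpRing : Type _ := Gr (IsLocalRing.maximalIdeal (SgpRing k S))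

/-- The canonical presentation `k[x_g : g a minimal generator of S] → gr_𝔪(R)`: it sends the
variable `x_g` to the class of `t ^ g` in the degree one piece `𝔪 / 𝔪 ^ 2`. -/
def grPresentation : MvPolynomial (minGens S) k →+* GrSgpRing k S :=
  MvPolynomial.eval₂Hom
    ((grOfRing (IsLocalRing.maximalIdeal (SgpRing k S))).comp (algebraMap k (SgpRing k S)))
    (fun g => DirectSum.of (GrPiece (IsLocalRing.maximalIdeal (SgpRing k S))) 1
      (grMk _ 1 (tPow k S g.1 g.2.1)
        ((pow_one (IsLocalRing.maximalIdeal (SgpRing k S))).symm ▸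
          tPow_mem_maximalIdeal k S g.1 g.2.1 g.2.2.1)))

/-- The defining ideal `I*` of `gr_𝔪(R)`. -/
def grIdeal : Ideal (MvPolynomial (minGens S) k) := RingHom.ker (grPresentation k S)

/-- `gr_𝔪(R)` is a complete intersection: the minimal number of generators of its defining ideal
`I*` is `ν - 1`, where `ν` is the number of minimal generators of `S`. -/
def GrIsCompleteIntersection : Prop :=
  (grIdeal k S).FG ∧ Submodule.spanFinrank (grIdeal k S) + 1 = (minGens S).ncard

end SemigroupRing

end NumSgp

end

open scoped PowerSeries DirectSum

noncomputable section

/-! All the monomials `t ^ (n g * g)` equal `t ^ N`. Hence, with `g₀` the smallest minimal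
generator, `n g` copies of `g ≠ g₀` can be traded for the larger number `n g₀` of copies of `g₀`,
which puts `x_g ^ n g` in `I*`. Conversely, coprimality makes an exponent vector with `a g < n g`
for all `g ≠ g₀` unique in its weight, and trading shows that it has the largest degree there
(`eq_or_degree_lt`). A homogeneous element of `I*` cannot contain such a monomial: its value would
have a term of too low an order to lie in the next power of `𝔪`. So `I*` is generated by these pure
powers (`grIdeal_eq_span`), one for each minimal generator except `g₀`, and no smaller set generates
it (`spanFinrank_span_X_pow`). -/

namespace NumSgp

/-! ### Exponent vectors of maximal degree in a given weight. -/

section NormalForm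

open Finsupp

variable {σ : Type*} {h n : σ → ℕ} {N : ℕ} {i₀ : σ}

/-- Trading `n j` copies of the variable `j` for `n i₀` copies of `i₀` keeps the weight and
raises the degree. -/
theorem exists_weight_eq_degree_lt (hn : ∀ i, n i * h i = N) (hlt : ∀ j ≠ i₀, n j < n i₀)
    {a : σ →₀ ℕ} {j : σ} (hj : j ≠ i₀) (haj : n j ≤ a j) :
    ∃ b, weight h b = weight h a ∧ a.degree < b.degree := by
  obtain ⟨c, rfl⟩ := exists_add_of_le (single_le_iff.2 haj)
  refine ⟨single i₀ (n i₀) + c, ?_, ?_⟩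
  · simp [weight_single, hn]
  · simpa using hlt j hj

variable [Fintype σ]

theorem weight_eq_sum (h : σ → ℕ) (a : σ →₀ ℕ) : weight h a = ∑ i, a i * h i := by
  rw [weight_apply, Finsupp.sum_fintype _ _ (by simp)]
  simp

theorem degree_le_weight (hh : ∀ i, 0 < h i) (a : σ →₀ ℕ) : a.degree ≤ weight h a := by
  rw [weight_eq_sum, degree_eq_sum]
  exact Finset.sum_le_sum fun i _ => Nat.le_mul_of_pos_right _ (hh i)

/-- For `j ≠ i`, `n i` divides `N = n j * h j` and is coprime to `n j`, so it divides `h j`: only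
the `i`-th term survives modulo `n i`. -/
theorem weight_modEq (hn : ∀ i, n i * h i = N)
    (hcop : Pairwise fun i j => (n i).Coprime (n j)) (a : σ →₀ ℕ) (i : σ) :
    weight h a ≡ a i * h i [MOD n i] := by
  rw [weight_eq_sum]
  have key : ∀ j, j ≠ i → n i ∣ h j := fun j hj =>
    (hcop hj.symm).dvd_of_dvd_mul_left ((hn j).trans (hn i).symm ▸ dvd_mul_right _ _)
  classical
  rw [← Finset.add_sum_erase _ _ (Finset.mem_univ i)]
  have : n i ∣ ∑ j ∈ Finset.univ.erase i, a j * h j :=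
    Finset.dvd_sum fun j hj => (key j (Finset.ne_of_mem_erase hj)).mul_left _
  simpa using (Nat.modEq_zero_iff_dvd.2 this).add_left (a i * h i)

/-- Modulo `n j`, the weight determines `a j` up to the unit `h j`, and `a j < n j` fixes it. The
remaining coordinate at `i₀` is then read off from the weight itself. -/
theorem eq_of_weight_eq (hn : ∀ i, n i * h i = N) (hh : ∀ i, 0 < h i)
    (hcop : Pairwise fun i j => (n i).Coprime (n j)) (hc : ∀ i, (n i).Coprime (h i))
    {a b : σ →₀ ℕ} (ha : ∀ j ≠ i₀, a j < n j) (hb : ∀ j ≠ i₀, b j < n j)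
    (hab : weight h b = weight h a) : b = a := by
  have key : ∀ j ≠ i₀, b j = a j := fun j hj => by
    have h1 : b j * h j ≡ a j * h j [MOD n j] :=
      (weight_modEq hn hcop b j).symm.trans (hab ▸ weight_modEq hn hcop a j)
    exact (Nat.ModEq.cancel_right_of_coprime (hc j) h1).eq_of_lt_of_lt (hb j hj) (ha j hj)
  ext i
  by_cases hi : i = i₀
  · subst hi
    classical
    rw [weight_eq_sum, weight_eq_sum, ← Finset.add_sum_erase _ _ (Finset.mem_univ i),
      ← Finset.add_sum_erase _ _ (Finset.mem_univ i),
      Finset.sum_congr rfl fun j hj => by rw [key j (Finset.ne_of_mem_erase hj)]] at hab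
    exact Nat.eq_of_mul_eq_mul_right (hh i) (Nat.add_right_cancel hab)
  · exact key i hi

/-- A normal form is the unique exponent of maximal degree of its weight. -/
theorem eq_or_degree_lt (hn : ∀ i, n i * h i = N) (hh : ∀ i, 0 < h i)
    (hcop : Pairwise fun i j => (n i).Coprime (n j)) (hc : ∀ i, (n i).Coprime (h i))
    (hlt : ∀ j ≠ i₀, n j < n i₀) {a : σ →₀ ℕ} (ha : ∀ j ≠ i₀, a j < n j) (b : σ →₀ ℕ)
    (hab : weight h b = weight h a) : b = a ∨ b.degree < a.degree := by
  -- Each trade raises the degree, which is bounded by the fixed weight, so the gap decreases.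
  induction hm : weight h a - b.degree using Nat.strong_induction_on generalizing b with
  | _ m ih =>
    by_cases hb : ∀ j ≠ i₀, b j < n j
    · exact .inl (eq_of_weight_eq hn hh hcop hc ha hb hab)
    · push Not at hb
      obtain ⟨j, hj, hbj⟩ := hb
      obtain ⟨c, hc1, hc2⟩ := exists_weight_eq_degree_lt hn hlt hj hbj
      have := degree_le_weight hh c
      right
      rcases ih _ (by omega) c (hc1.trans hab) rfl with rfl | hlt'
      · exact hc2
      · omega

end NormalForm

/-! ### Ideals generated by pure powers of variables. -/

section MonomialIdeal

open MvPolynomial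

variable {k σ : Type*} [Field k] {n : σ → ℕ} {J : Set σ}

theorem mem_span_X_pow_iff {p : MvPolynomial σ k} :
    p ∈ Ideal.span ((fun j => X j ^ n j) '' J : Set (MvPolynomial σ k)) ↔
      ∀ a ∈ p.support, ∃ j ∈ J, n j ≤ a j := by
  have := @mem_ideal_span_monomial_image σ k _ p ((fun j => Finsupp.single j (n j)) '' J)
  rw [Set.image_image] at this
  simpa [X_pow_eq_monomial] using this

/-- Among the monomials in the ideal, the only one dividing `X i ^ n i` is that power itself, so
only the constant term of `q` contributes. -/
theorem coeff_mul_of_mem_span_X_pow (hn : ∀ j, n j ≠ 0) {p : MvPolynomial σ k}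
    (hp : p ∈ Ideal.span ((fun j => X j ^ n j) '' J : Set (MvPolynomial σ k)))
    (q : MvPolynomial σ k) (i : σ) :
    coeff (Finsupp.single i (n i)) (q * p) =
      constantCoeff q * coeff (Finsupp.single i (n i)) p := by
  classical
  rw [coeff_mul, Finset.sum_eq_single (0, Finsupp.single i (n i))]
  · rfl
  · rintro ⟨u, v⟩ huv hne
    rw [Finset.HasAntidiagonal.mem_antidiagonal] at huv
    refine mul_eq_zero_of_right _ (by_contra fun hv => hne ?_)
    obtain ⟨j, -, hj⟩ := mem_span_X_pow_iff.1 hp v (mem_support_iff.2 hv)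
    have hij : i = j := by
      by_contra hij
      have := DFunLike.congr_fun huv j
      simp only [Finsupp.add_apply, Finsupp.single_apply, if_neg hij] at this
      have := hn j
      omega
    subst hij
    have hle : Finsupp.single i (n i) ≤ v := Finsupp.single_le_iff.2 hj
    obtain ⟨w, rfl⟩ := exists_add_of_le hle
    have h0 : u + w = 0 := by
      have : Finsupp.single i (n i) + (u + w) = Finsupp.single i (n i) + 0 := by
        rw [add_zero, add_left_comm]; exact huv
      exact add_left_cancel this
    obtain ⟨rfl, rfl⟩ := add_eq_zero.1 h0
    simp
  · simp

/-- For the lower bound, the coefficients at the generators form a map onto `k ^ J`, semilinear over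
`constantCoeff`. Generators of the ideal therefore map to a spanning set of a space of dimension
`J.ncard`. -/
theorem spanFinrank_span_X_pow (hn : ∀ j, n j ≠ 0) (hJ : J.Finite) :
    (Ideal.span ((fun j => X j ^ n j) '' J : Set (MvPolynomial σ k))).spanFinrank = J.ncard := by
  classical
  set I := Ideal.span ((fun j => X j ^ n j) '' J : Set (MvPolynomial σ k)) with hI
  have hfg : I.FG := Submodule.fg_span (hJ.image _)
  refine le_antisymm ?_ ?_
  · exact (Submodule.spanFinrank_span_le_ncard_of_finite (hJ.image _)).trans
      (Set.ncard_image_le hJ)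
  · have : Fintype J := hJ.fintype
    have : RingHomSurjective (constantCoeff : MvPolynomial σ k →+* k) :=
      ⟨fun c => ⟨C c, constantCoeff_C _ c⟩⟩
    let f : I →ₛₗ[(constantCoeff : MvPolynomial σ k →+* k)] (J → k) :=
      { toFun := fun p j => coeff (Finsupp.single j.1 (n j)) p.1
        map_add' := fun p q => by ext; simp
        map_smul' := fun q p => by
          ext j
          exact coeff_mul_of_mem_span_X_pow hn p.2 q j }
    have hf : Submodule.map f ⊤ = ⊤ := by
      rw [eq_top_iff, ← (Pi.basisFun k J).span_eq, Submodule.span_le]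
      rintro _ ⟨j, rfl⟩
      refine ⟨⟨X j.1 ^ n j, Ideal.subset_span ⟨j, j.2, rfl⟩⟩, trivial, ?_⟩
      ext l
      simp only [f, LinearMap.coe_mk, AddHom.coe_mk, X_pow_eq_monomial, coeff_monomial,
        Pi.basisFun_apply, Pi.single_apply]
      refine if_congr ⟨fun e => ?_, fun e => by rw [e]⟩ rfl rfl
      have := DFunLike.congr_fun e j.1
      by_contra hlj
      rw [Finsupp.single_eq_same, Finsupp.single_apply,
        if_neg fun e => hlj (Subtype.ext e)] at this
      exact hn _ this
    have := Submodule.spanFinrank_map_le_of_fg f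
      ((Submodule.fg_top I).2 hfg)
    rw [hf, Submodule.spanFinrank_top, ← Module.finrank_eq_spanFinrank_of_free,
      Module.finrank_fintype_fun_eq_card] at this
    rwa [← Nat.card_coe_set_eq, Nat.card_eq_fintype_card]

end MonomialIdeal

/-! ### Minimal generators of a submonoid of `ℕ`. -/

section MinimalGenerators

variable {S : AddSubmonoid ℕ}

theorem closure_minGens (S : AddSubmonoid ℕ) : AddSubmonoid.closure (minGens S) = S := by
  refine le_antisymm (AddSubmonoid.closure_le.2 fun s hs => hs.1) fun s hs => ?_
  induction s using Nat.strong_induction_on with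
  | _ s ih =>
    by_cases h : s ∈ minGens S
    · exact AddSubmonoid.subset_closure h
    · rcases eq_or_ne s 0 with rfl | h0
      · exact zero_mem _
      · simp only [minGens, Set.mem_ofPred_eq, not_and, not_forall] at h
        obtain ⟨t, ht, ht0, ⟨u, hu, rfl⟩, hne⟩ := h hs h0
        exact add_mem (ih t (by omega) ht) (ih u (by omega) hu)

theorem minGens_closure_subset (A : Set ℕ) : minGens (AddSubmonoid.closure A) ⊆ A := by
  rintro s ⟨hs, h0, hmin⟩
  induction hs using AddSubmonoid.closure_induction with
  | mem x hx => exact hx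
  | zero => exact absurd rfl h0
  | add x y hx hy ihx ihy =>
    rcases eq_or_ne x 0 with rfl | hx0
    · rw [zero_add] at h0 hmin ⊢
      exact ihy h0 hmin
    · have := hmin x hx hx0 ⟨y, hy, rfl⟩
      obtain rfl : y = 0 := by omega
      rw [add_zero] at h0 hmin ⊢
      exact ihx h0 hmin

/-- The element of `S` with a given exponent vector on the minimal generators. -/
abbrev minGensWeight (a : minGens S →₀ ℕ) : ℕ :=
  Finsupp.weight (fun g : minGens S => (g : ℕ)) a

theorem exists_minGensWeight_eq {s : ℕ} (hs : s ∈ S) :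
    ∃ a : minGens S →₀ ℕ, minGensWeight a = s := by
  rw [← closure_minGens S] at hs
  induction hs using AddSubmonoid.closure_induction with
  | mem x hx => exact ⟨Finsupp.single ⟨x, hx⟩ 1, by simp [Finsupp.weight_single]⟩
  | zero => exact ⟨0, map_zero _⟩
  | add x y _ _ ihx ihy =>
    obtain ⟨a, rfl⟩ := ihx
    obtain ⟨b, rfl⟩ := ihy
    exact ⟨a + b, map_add _ _ _⟩

end MinimalGenerators

/-! ### Powers of `𝔪` and the presentation of the associated graded ring. -/

section Presentation

open MvPolynomial IsLocalRing

variable {k : Type*} [Field k] {S : AddSubmonoid ℕ}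

variable (k S) in
/-- The power series all of whose exponents are sums of at least `d` minimal generators. -/
def orderIdeal (d : ℕ) : Ideal (SgpRing k S) where
  carrier := {f | ∀ s, PowerSeries.coeff s (f : k⟦X⟧) ≠ 0 →
    ∃ a : minGens S →₀ ℕ, minGensWeight a = s ∧ d ≤ a.degree}
  add_mem' := by
    intro f g hf hg s hs
    by_cases h : PowerSeries.coeff s (f : k⟦X⟧) = 0
    · exact hg s (by simpa [h] using hs)
    · exact hf s h
  zero_mem' := fun s hs => absurd (by simp) hs
  smul_mem' := by
    intro f g hg s hs
    change PowerSeries.coeff s ((f : k⟦X⟧) * (g : k⟦X⟧)) ≠ 0 at hs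
    rw [PowerSeries.coeff_mul] at hs
    obtain ⟨p, hp, hne⟩ := Finset.exists_ne_zero_of_sum_ne_zero hs
    obtain ⟨a, ha⟩ := exists_minGensWeight_eq (f.2 _ (left_ne_zero_of_mul hne))
    obtain ⟨b, hb, hd⟩ := hg _ (right_ne_zero_of_mul hne)
    refine ⟨a + b, ?_, ?_⟩
    · rw [← Finset.HasAntidiagonal.mem_antidiagonal.1 hp, ← ha, ← hb]
      exact map_add _ _ _
    · rw [map_add]
      omega

theorem mem_orderIdeal {d : ℕ} {f : SgpRing k S} :
    f ∈ orderIdeal k S d ↔ ∀ s, PowerSeries.coeff s (f : k⟦X⟧) ≠ 0 →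
      ∃ a : minGens S →₀ ℕ, minGensWeight a = s ∧ d ≤ a.degree := Iff.rfl

theorem orderIdeal_mul_le (i j : ℕ) :
    orderIdeal k S i * orderIdeal k S j ≤ orderIdeal k S (i + j) := by
  rw [Ideal.mul_le]
  intro f hf g hg s hs
  change PowerSeries.coeff s ((f : k⟦X⟧) * (g : k⟦X⟧)) ≠ 0 at hs
  rw [PowerSeries.coeff_mul] at hs
  obtain ⟨p, hp, hne⟩ := Finset.exists_ne_zero_of_sum_ne_zero hs
  obtain ⟨a, ha, hda⟩ := hf _ (left_ne_zero_of_mul hne)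
  obtain ⟨b, hb, hdb⟩ := hg _ (right_ne_zero_of_mul hne)
  refine ⟨a + b, ?_, ?_⟩
  · rw [← Finset.HasAntidiagonal.mem_antidiagonal.1 hp, ← ha, ← hb]
    exact map_add _ _ _
  · rw [map_add]
    omega

theorem maximalIdeal_le_orderIdeal : maximalIdeal (SgpRing k S) ≤ orderIdeal k S 1 := by
  intro f hf s hs
  rw [mem_maximalIdeal, mem_nonunits_iff, isUnit_sgpRing_iff, not_not] at hf
  obtain ⟨a, rfl⟩ := exists_minGensWeight_eq (f.2 s hs)
  refine ⟨a, rfl, Nat.one_le_iff_ne_zero.2 fun h0 => hs ?_⟩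
  rw [Finsupp.degree_eq_zero_iff] at h0
  simpa [h0] using hf

/-- This inclusion alone suffices to refute membership in a power of `𝔪`; the reverse one is not
needed. -/
theorem maximalIdeal_pow_le_orderIdeal (d : ℕ) :
    maximalIdeal (SgpRing k S) ^ d ≤ orderIdeal k S d := by
  induction d with
  | zero =>
    intro f _ s hs
    obtain ⟨a, rfl⟩ := exists_minGensWeight_eq (f.2 s hs)
    exact ⟨a, rfl, Nat.zero_le _⟩
  | succ d ih =>
    rw [pow_succ]
    exact (Ideal.mul_mono ih maximalIdeal_le_orderIdeal).trans (orderIdeal_mul_le d 1)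

variable (k S) in
/-- The `k`-algebra homomorphism sending the variable `x_g` to `t ^ g`. -/
def evalTPow : MvPolynomial (minGens S) k →ₐ[k] SgpRing k S :=
  aeval fun g => tPow k S g.1 g.2.1

theorem coe_evalTPow_monomial (a : minGens S →₀ ℕ) (c : k) :
    (evalTPow k S (monomial a c) : k⟦X⟧) = PowerSeries.monomial (minGensWeight a) c := by
  have : (SgpRing k S).val (evalTPow k S (monomial a c)) =
      PowerSeries.monomial (minGensWeight a) c := by
    rw [evalTPow, aeval_monomial, map_mul, AlgHom.commutes, Finsupp.prod, map_prod]
    simp only [map_pow]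
    have hmon (m : ℕ) :
        PowerSeries.monomial m c = PowerSeries.C c * (PowerSeries.X : k⟦X⟧) ^ m := by
      ext; rw [PowerSeries.coeff_C_mul_X_pow, PowerSeries.coeff_monomial]
    rw [hmon, minGensWeight, Finsupp.weight_apply, Finsupp.sum,
      PowerSeries.algebraMap_apply, Algebra.algebraMap_self_apply]
    congr 1
    rw [← Finset.prod_pow_eq_pow_sum]
    refine Finset.prod_congr rfl fun g _ => ?_
    rw [smul_eq_mul, mul_comm, pow_mul]
    rfl
  exact this

theorem coeff_evalTPow (p : MvPolynomial (minGens S) k) (s : ℕ) :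
    PowerSeries.coeff s (evalTPow k S p : k⟦X⟧) =
      ∑ a ∈ p.support with minGensWeight a = s, coeff a p := by
  have : (evalTPow k S p : k⟦X⟧) =
      ∑ a ∈ p.support, PowerSeries.monomial (minGensWeight a) (coeff a p) := by
    conv_lhs => rw [p.as_sum]
    rw [map_sum, AddSubmonoidClass.coe_finsetSum]
    simp only [coe_evalTPow_monomial]
  rw [this, map_sum, Finset.sum_filter]
  refine Finset.sum_congr rfl fun a _ => ?_
  rw [PowerSeries.coeff_monomial]
  exact if_congr eq_comm rfl rfl

variable (k S) in
/-- The canonical presentation sends `p` to the initial form in degree `d` of the power series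
obtained by substituting the monomials `t ^ g`. -/
def PresentsInDegree (d : ℕ) (p : MvPolynomial (minGens S) k) : Prop :=
  ∃ h : evalTPow k S p ∈ maximalIdeal (SgpRing k S) ^ d,
    grPresentation k S p = DirectSum.of (GrPiece (maximalIdeal (SgpRing k S))) d
      (grMk _ d (evalTPow k S p) h)

theorem of_grMk_congr {R : Type*} [CommRing R] {I : Ideal R} {d : ℕ} {a b : R} (h : a = b)
    (ha : a ∈ I ^ d) (hb : b ∈ I ^ d) :
    DirectSum.of (GrPiece I) d (grMk I d a ha) = DirectSum.of (GrPiece I) d (grMk I d b hb) := by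
  subst h; rfl

namespace PresentsInDegree

variable {d e : ℕ} {p q : MvPolynomial (minGens S) k}

theorem zero : PresentsInDegree k S d 0 := by
  refine ⟨by simp, ?_⟩
  rw [map_zero, of_grMk_congr (map_zero _) _ (zero_mem _), grMk_zero, map_zero]

theorem add (hp : PresentsInDegree k S d p) (hq : PresentsInDegree k S d q) :
    PresentsInDegree k S d (p + q) := by
  obtain ⟨hp, hp'⟩ := hp
  obtain ⟨hq, hq'⟩ := hq
  refine ⟨map_add (evalTPow k S) p q ▸ add_mem hp hq, ?_⟩
  rw [map_add, hp', hq', ← map_add, grMk_add]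
  exact of_grMk_congr (map_add _ _ _).symm _ _

theorem mul (hp : PresentsInDegree k S d p) (hq : PresentsInDegree k S e q) :
    PresentsInDegree k S (d + e) (p * q) := by
  obtain ⟨hp, hp'⟩ := hp
  obtain ⟨hq, hq'⟩ := hq
  refine ⟨by rw [map_mul, pow_add]; exact Ideal.mul_mem_mul hp hq, ?_⟩
  rw [map_mul, hp', hq', DirectSum.of_mul_of]
  exact of_grMk_congr (map_mul _ _ _).symm _ _

theorem C (c : k) : PresentsInDegree k S 0 (MvPolynomial.C c) := by
  refine ⟨by simp, ?_⟩
  rw [grPresentation, coe_eval₂Hom, eval₂_C]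
  exact of_grMk_congr (aeval_C _ c).symm (by simp) _

theorem X (g : minGens S) : PresentsInDegree k S 1 (MvPolynomial.X g) := by
  have h : evalTPow k S (MvPolynomial.X g) = tPow k S g.1 g.2.1 := aeval_X _ g
  have hm := tPow_mem_maximalIdeal k S g.1 g.2.1 g.2.2.1
  refine ⟨by rw [h, pow_one]; exact hm, ?_⟩
  rw [grPresentation, coe_eval₂Hom, eval₂_X]
  exact of_grMk_congr h.symm _ _

theorem X_pow (g : minGens S) (m : ℕ) : PresentsInDegree k S m (MvPolynomial.X g ^ m) := by
  induction m with
  | zero => simpa using C (S := S) (1 : k)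
  | succ m ih => rw [pow_succ]; exact ih.mul (X g)

theorem monomial (a : minGens S →₀ ℕ) (c : k) :
    PresentsInDegree k S a.degree (MvPolynomial.monomial a c) := by
  have key : PresentsInDegree k S a.degree (MvPolynomial.monomial a (1 : k)) := by
    induction a using Finsupp.induction_linear with
    | zero => simpa using C (S := S) (1 : k)
    | add a b ha hb =>
      rw [map_add, ← one_mul (1 : k), ← monomial_mul]
      exact ha.mul hb
    | single g m =>
      rw [Finsupp.degree_single, ← X_pow_eq_monomial]
      exact X_pow g m
  have := (C (S := S) c).mul key
  rwa [zero_add, C_mul_monomial, mul_one] at this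

theorem of_isHomogeneous (hp : p.IsHomogeneous d) : PresentsInDegree k S d p := by
  rw [p.as_sum]
  refine Finset.sum_induction _ (PresentsInDegree k S d) (fun _ _ => add) zero fun a ha => ?_
  have := monomial (k := k) a (coeff a p)
  rwa [show a.degree = d from by
    rw [Finsupp.degree_eq_weight_one]; exact hp (mem_support_iff.1 ha)] at this

/-- Turns vanishing in the graded ring into membership in a power of `𝔪`, which can be tested on
coefficients. -/
theorem eq_zero_iff (hp : PresentsInDegree k S d p) :
    grPresentation k S p = 0 ↔ evalTPow k S p ∈ maximalIdeal (SgpRing k S) ^ (d + 1) := by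
  obtain ⟨h, h'⟩ := hp
  rw [h', map_eq_zero_iff _ (DirectSum.of_injective d), ← grMk_zero, grMk_eq_iff, sub_zero]

end PresentsInDegree

/-- `I*` is homogeneous: components of different degrees land in different summands. -/
theorem grPresentation_homogeneousComponent_eq_zero {p : MvPolynomial (minGens S) k}
    (hp : grPresentation k S p = 0) (d : ℕ) :
    grPresentation k S (homogeneousComponent d p) = 0 := by
  have key : ∀ e, ∃ x : GrPiece (maximalIdeal (SgpRing k S)) e,
      grPresentation k S (homogeneousComponent e p) = DirectSum.of _ e x := fun e =>
    ⟨_, (PresentsInDegree.of_isHomogeneous (homogeneousComponent_isHomogeneous e p)).2⟩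
  choose x hx using key
  by_cases hd : d ∈ Finset.range (p.totalDegree + 1)
  · rw [← sum_homogeneousComponent p, map_sum] at hp
    have := DFunLike.congr_fun hp d
    simp only [hx] at this
    rw [DirectSum.sum_apply, Finset.sum_eq_single d
      (fun e _ he => DirectSum.of_eq_of_ne _ _ _ he.symm) (fun h => absurd hd h),
      DirectSum.of_eq_same] at this
    rw [hx, this]
    exact map_zero _
  · rw [homogeneousComponent_eq_zero _ _ (by simpa using hd), map_zero]

end Presentation

/-! ### The tangent cone is cut out by pure powers. -/

section CompleteIntersection

open MvPolynomial IsLocalRing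

variable {k : Type*} [Field k] {S : AddSubmonoid ℕ}

/-- If `n g * g` does not depend on the minimal generator `g`, under the stated coprimality
conditions, the tangent cone is defined by the powers `x_g ^ n g` for `g ≠ g₀`, where `g₀` is the
minimal generator with `n g₀` maximal. -/
theorem grIdeal_eq_span [Finite (minGens S)] {n : minGens S → ℕ} {N : ℕ} {g₀ : minGens S}
    (hn : ∀ g, n g * (g : ℕ) = N) (hcop : Pairwise fun g g' => (n g).Coprime (n g'))
    (hc : ∀ g, (n g).Coprime (g : ℕ)) (hlt : ∀ g ≠ g₀, n g < n g₀) :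
    grIdeal k S = Ideal.span ((fun g => X g ^ n g) '' {g | g ≠ g₀}) := by
  have := Fintype.ofFinite (minGens S)
  have hh : ∀ g : minGens S, 0 < (g : ℕ) := fun g => Nat.pos_of_ne_zero g.2.2.1
  refine le_antisymm (fun p hp => ?_) (Ideal.span_le.2 ?_)
  · rw [mem_span_X_pow_iff]
    intro a ha
    by_contra! hnorm
    have hp0 := grPresentation_homogeneousComponent_eq_zero (RingHom.mem_ker.1 hp) a.degree
    rw [(PresentsInDegree.of_isHomogeneous
      (homogeneousComponent_isHomogeneous a.degree p)).eq_zero_iff] at hp0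
    -- The coefficient of `t` at the weight of `a` is `coeff a p`: any other monomial of that weight
    -- has smaller degree, hence is absent from this component. An expression of degree above
    -- `a.degree` would then exist, against maximality.
    obtain ⟨b, hb, hdeg⟩ := mem_orderIdeal.1 (maximalIdeal_pow_le_orderIdeal _ hp0)
      (minGensWeight a) (by
        rw [coeff_evalTPow, Finset.sum_eq_single a]
        · rw [coeff_homogeneousComponent, if_pos rfl]
          exact mem_support_iff.1 ha
        · intro b hb hba
          rw [Finset.mem_filter, mem_support_iff, coeff_homogeneousComponent] at hb
          have hdeg : b.degree = a.degree := by_contra fun h => hb.1 (if_neg h)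
          rcases eq_or_degree_lt hn hh hcop hc hlt hnorm b hb.2 with h | h
          · exact absurd h hba
          · omega
        · intro h
          simpa [coeff_homogeneousComponent] using h)
    rcases eq_or_degree_lt hn hh hcop hc hlt hnorm b hb with rfl | h <;> omega
  · rintro _ ⟨g, hg, rfl⟩
    rw [SetLike.mem_coe, grIdeal, RingHom.mem_ker, (PresentsInDegree.X_pow g (n g)).eq_zero_iff]
    -- Both sides are `t ^ N`, and the right one visibly lies in `𝔪 ^ n g₀`, with `n g₀ ≥ n g + 1`.
    have key : evalTPow k S (X g ^ n g) = evalTPow k S (X g₀ ^ n g₀) := by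
      refine Subtype.ext ?_
      rw [X_pow_eq_monomial, X_pow_eq_monomial, coe_evalTPow_monomial, coe_evalTPow_monomial]
      simp [minGensWeight, Finsupp.weight_single, hn]
    rw [key]
    exact Ideal.pow_le_pow_right (hlt g hg) (PresentsInDegree.X_pow g₀ (n g₀)).1

/-- The exponents are `N / g`, so the smallest minimal generator plays the role of `g₀`. -/
theorem grIsCompleteIntersection_of_dvd {N : ℕ} (hN : N ≠ 0) (hne : (minGens S).Nonempty)
    (hdvd : ∀ g ∈ minGens S, g ∣ N) (hc : ∀ g ∈ minGens S, (N / g).Coprime g)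
    (hcop : (minGens S).Pairwise fun g g' => (N / g).Coprime (N / g')) :
    GrIsCompleteIntersection k S := by
  have hfin : (minGens S).Finite :=
    (Set.finite_Iic N).subset fun g hg => Nat.le_of_dvd (Nat.pos_of_ne_zero hN) (hdvd g hg)
  have : Finite (minGens S) := hfin
  obtain ⟨g₀, hg₀, hmin⟩ := hfin.exists_minimalFor id _ hne
  have hn : ∀ g : minGens S, N / (g : ℕ) * g = N := fun g => Nat.div_mul_cancel (hdvd g g.2)
  have hlt : ∀ g ≠ (⟨g₀, hg₀⟩ : minGens S), N / (g : ℕ) < N / g₀ := fun g hg => by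
    have h1 : g₀ < g := lt_of_le_of_ne (le_of_not_gt fun h => absurd (hmin g.2 h.le) (not_le.2 h))
      fun h => hg (Subtype.ext h.symm)
    by_contra! h
    have h2 := hn g
    have h3 := hn ⟨g₀, hg₀⟩
    have h4 : 0 < N / (g : ℕ) := Nat.pos_of_ne_zero fun h0 => hN (by rw [← h2, h0, zero_mul])
    have := Nat.mul_lt_mul_of_le_of_lt h h1 h4
    simp only at h3
    omega
  rw [GrIsCompleteIntersection, grIdeal_eq_span hn
    (fun g g' hgg' => hcop g.2 g'.2 fun h => hgg' (Subtype.ext h)) (fun g => hc g g.2) hlt]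
  refine ⟨Submodule.fg_span ((Set.toFinite _).image _), ?_⟩
  rw [spanFinrank_span_X_pow (fun g h0 => hN (by rw [← hn g, h0, zero_mul])) (Set.toFinite _)]
  have : {g | g ≠ (⟨g₀, hg₀⟩ : minGens S)} = Set.univ \ {⟨g₀, hg₀⟩} := by ext; simp
  rw [this, Set.ncard_sdiff_singleton_add_one (Set.mem_univ _) (Set.toFinite _), Set.ncard_univ,
    Nat.card_coe_set_eq]

end CompleteIntersection

end NumSgp

end

/-- Only the inclusion of the minimal generators in the given ones is used. It can be strict: if the
last `n i` is `1` and `ν > 1`, its generator `N` is a multiple of the others. -/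
theorem mainTheorem5 (k : Type*) [Field k] [Infinite k] (ν : ℕ) (hν : 0 < ν)
    (n : Fin ν → ℕ) (hpos : ∀ i, 0 < n i) (hanti : StrictAnti n)
    (hcop : Pairwise (fun i j => Nat.Coprime (n i) (n j))) :
    NumSgp.GrIsCompleteIntersection k
      (AddSubmonoid.closure (Set.range (fun i : Fin ν => (∏ j, n j) / n i))) := by
  have hN : ∏ j, n j ≠ 0 := Finset.prod_ne_zero_iff.2 fun i _ => (hpos i).ne'
  have hdvd : ∀ i, n i ∣ ∏ j, n j := fun i => Finset.dvd_prod_of_mem n (Finset.mem_univ i)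
  have hdiv : ∀ i, (∏ j, n j) / ((∏ j, n j) / n i) = n i := fun i => Nat.div_div_self (hdvd i) hN
  have hsub := NumSgp.minGens_closure_subset (Set.range fun i : Fin ν => (∏ j, n j) / n i)
  refine NumSgp.grIsCompleteIntersection_of_dvd hN ?_ ?_ ?_ ?_
  · by_contra hempty
    have h := NumSgp.closure_minGens
      (AddSubmonoid.closure (Set.range fun i : Fin ν => (∏ j, n j) / n i))
    rw [Set.not_nonempty_iff_eq_empty.1 hempty, AddSubmonoid.closure_empty] at h
    have h0 : (∏ j, n j) / n ⟨0, hν⟩ ∈ (⊥ : AddSubmonoid ℕ) :=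
      h ▸ AddSubmonoid.subset_closure ⟨_, rfl⟩
    rw [AddSubmonoid.mem_bot, Nat.div_eq_zero_iff] at h0
    have := hpos ⟨0, hν⟩
    have := Nat.le_of_dvd (Nat.pos_of_ne_zero hN) (hdvd ⟨0, hν⟩)
    omega
  · intro g hg
    obtain ⟨i, rfl⟩ := hsub hg
    exact Nat.div_dvd_of_dvd (hdvd i)
  · intro g hg
    obtain ⟨i, rfl⟩ := hsub hg
    simp only [hdiv]
    -- The generator is the product of the `n j` with `j ≠ i`, each coprime to `n i`.
    rw [← Finset.mul_prod_erase _ _ (Finset.mem_univ i), Nat.mul_div_cancel_left _ (hpos i)]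
    exact Nat.Coprime.prod_right fun j hj => hcop (Finset.ne_of_mem_erase hj).symm
  · intro g hg g' hg' hne
    obtain ⟨i, rfl⟩ := hsub hg
    obtain ⟨j, rfl⟩ := hsub hg'
    simp only [hdiv]
    exact hcop fun h => hne (by rw [h])
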